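/- Let $A$ and $B$ be finitely presented groups, put $G = A \times B$, and identify $A$ and $B$ with the subgroups $A \times \{1\}$ and $\{1\} \times B$ of $G$. Let $(U_n)_{n \ge 1}$ be a sequence of finite index subgroups of $G$ such that $[A : A \cap U_n] \to \infty$ and $[B : B \cap U_n] \to \infty$ as $n \to \infty$. For every $n$, let $\mathrm{Torsion}(U_n^{\mathrm{ab}})$ denote the torsion subgroup of the abelianization $U_n^{\mathrm{ab}} = U_n/[U_n,U_n]$. Then $\mathrm{Torsion}(U_n^{\mathrm{ab}})$ is finite for every $n$, and $$\lim_{n \to \infty} \frac{\log |\mathrm{Torsion}(U_n^{\mathrm{ab}})|}{[G : U_n]} = 0.$$ -/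

import Mathlib

open Filter Topology

/-! Write $U_A, U_B$ for the projections of $U$ and $q = [U_B : U \cap B] \le [G:U]$. The torsion of
$U^{\mathrm{ab}}$ is compared with that of $U_A^{\mathrm{ab}} \times U_B^{\mathrm{ab}}$.

For the target, $|\mathrm{Torsion}(U_A^{\mathrm{ab}})| \le a^{[A:U_A]}$, and likewise for $B$
(`exists_card_torsion_abelianization_le_pow_index`): cycles on the Schreier graph modulo lifted
relators of bounded length are controlled by a determinant. Since $[A:U_A]\,[B:B\cap U] \le [G:U]$,
the exponent is $o([G:U])$.

For the kernel, put $N = U \cap B$. It embeds in $([U_B,U_B] \cap N)/[N,U_B]$, the intersection of a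
central subgroup of index $q$ with the commutator subgroup of $U_B/[N,U_B]$. A quantitative Schur
theorem (`card_commutator_inf_dvd_pow_log`) bounds this by $q^{\log_2 q}$, which contributes
$O(\log^2 [G:U])$ to the logarithm. -/

/-! ### Determinant bounds for lattices of integer vectors. -/

/-- The absolute value of a determinant is at most the product of the `ℓ¹`-norms of the rows. -/
theorem Matrix.abs_det_le_prod_sum_abs {n : Type*} [Fintype n] [DecidableEq n]
    (M : Matrix n n ℤ) : |M.det| ≤ ∏ i, ∑ j, |M i j| := by
  classical
  rw [← Matrix.det_transpose, Matrix.det_apply]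
  calc |∑ σ : Equiv.Perm n, Equiv.Perm.sign σ • ∏ i, M.transpose (σ i) i|
      ≤ ∑ σ : Equiv.Perm n, |Equiv.Perm.sign σ • ∏ i, M.transpose (σ i) i| :=
        Finset.abs_sum_le_sum_abs _ _
    _ = ∑ σ : Equiv.Perm n, ∏ i, |M i (σ i)| := by
        refine Finset.sum_congr rfl fun σ _ => ?_
        rw [Units.smul_def, smul_eq_mul, abs_mul, Finset.abs_prod]
        rcases Int.units_eq_one_or (Equiv.Perm.sign σ) with h | h <;> simp [h]
    _ = ∑ f ∈ Finset.univ.image (fun σ : Equiv.Perm n => (σ : n → n)), ∏ i, |M i (f i)| := by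
        rw [Finset.sum_image]
        intro σ _ τ _ h
        exact DFunLike.coe_injective h
    -- Allowing all functions, not only permutations, makes the sum factor over the rows.
    _ ≤ ∑ f : n → n, ∏ i, |M i (f i)| :=
        Finset.sum_le_sum_of_subset_of_nonneg (Finset.subset_univ _)
          fun f _ _ => Finset.prod_nonneg fun i _ => abs_nonneg _
    _ = ∏ i, ∑ j, |M i j| := by
        rw [Finset.prod_univ_sum, Fintype.piFinset_univ]

/-- The rational vector with the same coordinates as an integer vector. -/
def intVecToRat (ι : Type*) : (ι → ℤ) →ₗ[ℤ] (ι → ℚ) where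
  toFun v i := v i
  map_add' v w := by ext; simp
  map_smul' k v := by ext; simp

/-- A family of linearly independent integer vectors of full size and of `ℓ¹`-norm at most `L`
spans a subgroup of index at most `L ^ n`. -/
theorem card_quotient_span_range_le {ι : Type*} [Fintype ι] {u : ι → ι → ℤ} {L : ℕ}
    (hu : LinearIndependent ℤ u) (hL : ∀ i, ∑ j, |u i j| ≤ L) :
    Finite ((ι → ℤ) ⧸ Submodule.span ℤ (Set.range u)) ∧
      Nat.card ((ι → ℤ) ⧸ Submodule.span ℤ (Set.range u)) ≤ L ^ Fintype.card ι := by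
  classical
  have hcard := Submodule.natAbs_det_basis_change (Pi.basisFun ℤ ι)
    (Submodule.span ℤ (Set.range u)) (Module.Basis.span hu)
  have hdet : (Pi.basisFun ℤ ι).det ((↑) ∘ Module.Basis.span hu) = (Matrix.of u).det := by
    rw [Pi.basisFun_det_apply]
    congr 1
    ext i j
    simp [Module.Basis.span_apply]
  rw [hdet] at hcard
  have hne : (Matrix.of u).det ≠ 0 := by
    intro h0
    obtain ⟨v, hv, hv0⟩ := Matrix.exists_vecMul_eq_zero_iff.2 h0
    refine hv (funext (Fintype.linearIndependent_iff.1 hu v ?_))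
    rw [Matrix.vecMul_eq_sum] at hv0
    exact hv0
  constructor
  · exact (Nat.card_pos_iff.1 (by
      rw [← hcard]; exact Int.natAbs_pos.2 hne)).2
  · rw [← hcard]
    zify
    refine (Matrix.abs_det_le_prod_sum_abs _).trans ?_
    calc ∏ i, ∑ j, |Matrix.of u i j| ≤ ∏ _i : ι, (L : ℤ) :=
          Finset.prod_le_prod (fun i _ => Finset.sum_nonneg fun j _ => abs_nonneg _)
            fun i _ => hL i
      _ = _ := by simp

/-- Let `R` be a set of integer vectors of `ℓ¹`-norm at most `L`. A set of vectors in the saturation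
of the span of `R` that are pairwise incongruent modulo this span has at most `L ^ n` elements. -/
theorem card_le_pow_of_injective_mod_span {ι T : Type*} [Fintype ι] {R : Set (ι → ℤ)} {L : ℕ}
    (hL1 : 1 ≤ L) (hR : ∀ v ∈ R, ∑ j, |v j| ≤ L) (f : T → ι → ℤ)
    (hsat : ∀ t, ∃ k : ℤ, k ≠ 0 ∧ k • f t ∈ Submodule.span ℤ R)
    (hinj : ∀ t t', f t - f t' ∈ Submodule.span ℤ R → t = t') :
    Finite T ∧ Nat.card T ≤ L ^ Fintype.card ι := by
  classical
  let c := intVecToRat ι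
  -- `b₀` is a maximal rationally independent subset of `R`; unit vectors then complete it to a
  -- basis `b` of the rational space. Both kinds of vectors have norm at most `L`.
  obtain ⟨b₀, hb₀R, -, hRb₀, hb₀⟩ := exists_linearIndepOn_extension (K := ℚ) (v := c)
    (linearIndepOn_empty ℚ c) (Set.empty_subset R)
  obtain ⟨b, hbt, hb₀b, htb, hb⟩ := exists_linearIndepOn_extension (K := ℚ) (v := c)
    (t := R ∪ Set.range fun i => (Pi.single i 1 : ι → ℤ)) hb₀
    (hb₀R.trans Set.subset_union_left)
  have hspan : ⊤ ≤ Submodule.span ℚ (Set.range fun x : b => c x) := by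
    rw [← (Pi.basisFun ℚ ι).span_eq, Submodule.span_le]
    rintro _ ⟨i, rfl⟩
    have h := htb ⟨Pi.single i 1, Or.inr ⟨i, rfl⟩, rfl⟩
    rw [Set.image_eq_range] at h
    convert h using 1
    ext j
    by_cases hij : j = i
    · subst hij; simp [c, intVecToRat]
    · simp [c, intVecToRat, hij]
  let B : Module.Basis b ℚ (ι → ℚ) := Module.Basis.mk hb hspan
  have hB : ∀ x : b, B x = c x := fun x => Module.Basis.mk_apply hb hspan x
  let e : ι ≃ b := (Pi.basisFun ℚ ι).indexEquiv B
  let u : ι → ι → ℤ := fun i => (e i : ι → ℤ)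
  have hu : LinearIndependent ℤ u := by
    have h1 : LinearIndependent ℤ fun x : b => c x :=
      LinearIndependent.restrict_scalars' (R := ℤ) (K := ℚ) hb
    have h2 : LinearIndependent ℤ (fun x : b => (x : ι → ℤ)) :=
      LinearIndependent.of_comp c h1
    exact h2.comp e e.injective
  have huL : ∀ i, ∑ j, |u i j| ≤ L := by
    intro i
    rcases hbt (e i).2 with h | ⟨k, hk⟩
    · exact hR _ h
    · have : u i = Pi.single k 1 := hk.symm
      rw [this, Finset.sum_eq_single k]
      · simpa using hL1
      · intro j _ hj; simp [hj]
      · simp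
  have hspanQ : ∀ w ∈ Submodule.span ℤ R, c w ∈ Submodule.span ℚ (c '' b₀) := by
    intro w hw
    induction hw using Submodule.span_induction with
    | mem x hx => exact hRb₀ ⟨x, hx, rfl⟩
    | zero => simp
    | add x y _ _ hx hy => rw [map_add]; exact add_mem hx hy
    | smul a x _ hx => rw [map_smul]; exact zsmul_mem hx a
  -- A saturated vector has rational coordinates supported on `b₀`; if it is also an integral
  -- combination of `b`, it is one of `b₀`. Hence incongruence modulo `R` persists modulo the
  -- full-rank lattice spanned by `u`.
  have hmeet : ∀ w : ι → ℤ, (∃ k : ℤ, k ≠ 0 ∧ k • w ∈ Submodule.span ℤ R) →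
      w ∈ Submodule.span ℤ (Set.range u) → w ∈ Submodule.span ℤ R := by
    rintro w ⟨k, hk, hkw⟩ hw
    obtain ⟨a, rfl⟩ := (Submodule.mem_span_range_iff_exists_fun ℤ).1 hw
    set w := ∑ i, a i • u i with hwdef
    have hcw : c w ∈ Submodule.span ℚ (c '' b₀) := by
      have h := Submodule.smul_mem _ ((k : ℚ)⁻¹) (hspanQ _ hkw)
      have hk' : (k : ℚ) ≠ 0 := by exact_mod_cast hk
      rwa [map_smul, ← Int.cast_smul_eq_zsmul ℚ, smul_smul, inv_mul_cancel₀ hk', one_smul] at h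
    have himg : c '' b₀ = B '' {x : b | (x : ι → ℤ) ∈ b₀} := by
      ext y
      constructor
      · rintro ⟨x, hx, rfl⟩
        exact ⟨⟨x, hb₀b hx⟩, hx, hB _⟩
      · rintro ⟨x, hx, rfl⟩
        exact ⟨x, hx, (hB x).symm⟩
    rw [himg, Module.Basis.mem_span_image] at hcw
    have hrepr : ∀ i, B.repr (c w) (e i) = a i := by
      intro i
      have : c w = ∑ j, (a j : ℚ) • B (e j) := by
        rw [hwdef, map_sum]
        refine Finset.sum_congr rfl fun j _ => ?_
        rw [map_smul, Int.cast_smul_eq_zsmul, hB]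
      rw [this, map_sum, Finsupp.finsetSum_apply, Finset.sum_eq_single i]
      · simp
      · intro j _ hj
        simp [hj]
      · simp
    refine Submodule.sum_mem _ fun i _ => ?_
    by_cases hai : a i = 0
    · simp [hai]
    · refine Submodule.smul_mem _ _ (Submodule.subset_span (hb₀R (hcw ?_)))
      rw [Finset.mem_coe, Finsupp.mem_support_iff, hrepr]
      exact_mod_cast hai
  obtain ⟨hfin, hcard⟩ := card_quotient_span_range_le hu huL
  have hg : Function.Injective
      (fun t => (Submodule.Quotient.mk (f t) : (ι → ℤ) ⧸ Submodule.span ℤ (Set.range u))) := by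
    intro t t' htt'
    refine hinj t t' (hmeet _ ?_ ((Submodule.Quotient.eq _).1 htt'))
    obtain ⟨k, hk, hkt⟩ := hsat t
    obtain ⟨k', hk', hkt'⟩ := hsat t'
    refine ⟨k * k', mul_ne_zero hk hk', ?_⟩
    rw [smul_sub, mul_comm, mul_smul, mul_comm, mul_smul]
    exact sub_mem (Submodule.smul_mem _ _ hkt) (Submodule.smul_mem _ _ hkt')
  exact ⟨Finite.of_injective _ hg, (Nat.card_le_card_of_injective _ hg).trans hcard⟩

/-! ### Edge counts of paths in Schreier graphs. -/

section PathVector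

variable {S X : Type*} [DecidableEq S] [DecidableEq X] [MulAction (FreeGroup S) X]

/-- The permutation of `X × (X × S → ℤ)` that moves a point of `X` along the edge labelled `s` and
records this edge. -/
def edgePerm (s : S) : Equiv.Perm (X × (X × S → ℤ)) where
  toFun y := (FreeGroup.of s • y.1, y.2 + Pi.single (y.1, s) 1)
  invFun y := ((FreeGroup.of s)⁻¹ • y.1, y.2 - Pi.single ((FreeGroup.of s)⁻¹ • y.1, s) 1)
  left_inv y := by simp
  right_inv y := by simp

/-- The signed count of the edges of the Schreier graph of `X` on the path that starts at `x` and
is labelled by the word `w`. -/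
def pathVector (w : FreeGroup S) (x : X) : X × S → ℤ :=
  (FreeGroup.lift (edgePerm (X := X)) w (x, 0)).2

/-- The recorded count never influences the motion, so starting from `m` merely translates the
result. This yields the cocycle rule `pathVector_mul`, with words read from right to left. -/
theorem lift_edgePerm_apply (w : FreeGroup S) (x : X) (m : X × S → ℤ) :
    FreeGroup.lift edgePerm w (x, m) = (w • x, m + pathVector w x) := by
  induction w using FreeGroup.induction_on generalizing x m with
  | C1 => simp [pathVector]
  | of s => simp [pathVector, edgePerm]
  | inv_of s _ =>
    have h : ∀ m : X × S → ℤ, (edgePerm s)⁻¹ (x, m) =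
      ((FreeGroup.of s)⁻¹ • x, m - Pi.single ((FreeGroup.of s)⁻¹ • x, s) 1) := fun m => rfl
    simp [pathVector, h, sub_eq_add_neg]
  | mul u v hu hv =>
    have h : ∀ m : X × S → ℤ, FreeGroup.lift edgePerm (u * v) (x, m) =
        ((u * v) • x, m + pathVector v x + pathVector u (v • x)) := fun m => by
      rw [map_mul, Equiv.Perm.mul_apply, hv, hu, mul_smul]
    have h₀ : pathVector (u * v) x = 0 + pathVector v x + pathVector u (v • x) :=
      congrArg Prod.snd (h 0)
    rw [h m, h₀, zero_add, add_assoc]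

theorem pathVector_mul (u v : FreeGroup S) (x : X) :
    pathVector (u * v) x = pathVector v x + pathVector u (v • x) := by
  rw [pathVector, map_mul, Equiv.Perm.mul_apply, lift_edgePerm_apply, lift_edgePerm_apply, zero_add]

theorem pathVector_one (x : X) : pathVector (1 : FreeGroup S) x = 0 := by
  simp [pathVector]

theorem pathVector_of (s : S) (x : X) : pathVector (FreeGroup.of s) x = Pi.single (x, s) 1 := by
  simp [pathVector, edgePerm]

theorem pathVector_inv (w : FreeGroup S) (x : X) :
    pathVector w⁻¹ x = -pathVector w (w⁻¹ • x) := by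
  have h := pathVector_mul w w⁻¹ x
  rw [mul_inv_cancel, pathVector_one] at h
  exact eq_neg_of_add_eq_zero_left h.symm

theorem sum_abs_pathVector_le [Fintype S] [Fintype X] (w : FreeGroup S) (x : X) :
    ∑ j, |pathVector w x j| ≤ w.norm := by
  have hsingle : ∀ (y : X) (s : S), ∑ j, |(Pi.single (y, s) 1 : X × S → ℤ) j| = 1 := by
    intro y s
    rw [Finset.sum_eq_single (y, s)]
    · simp
    · intro j _ hj; simp [hj]
    · simp
  have hmk : ∀ l : List (S × Bool), ∑ j, |pathVector (FreeGroup.mk l) x j| ≤ l.length := by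
    intro l
    induction l with
    | nil => simp [← FreeGroup.one_eq_mk, pathVector_one]
    | cons a l ih =>
      have hmul : FreeGroup.mk (a :: l) = FreeGroup.mk [a] * FreeGroup.mk l := by
        simp [FreeGroup.mul_mk]
      have hedge : ∀ y : X, ∑ j, |pathVector (FreeGroup.mk [a]) y j| = 1 := by
        intro y
        obtain ⟨s, _ | _⟩ := a
        · have : FreeGroup.mk [(s, false)] = (FreeGroup.of s)⁻¹ := rfl
          simp only [this, pathVector_inv, pathVector_of, Pi.neg_apply, abs_neg, hsingle]
        · have : FreeGroup.mk [(s, true)] = FreeGroup.of s := rfl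
          simp only [this, pathVector_of, hsingle]
      rw [hmul, pathVector_mul]
      calc ∑ j, |(pathVector (FreeGroup.mk l) x +
              pathVector (FreeGroup.mk [a]) (FreeGroup.mk l • x)) j|
          ≤ ∑ j, (|pathVector (FreeGroup.mk l) x j| +
              |pathVector (FreeGroup.mk [a]) (FreeGroup.mk l • x) j|) :=
            Finset.sum_le_sum fun j _ => abs_add_le _ _
        _ ≤ ((a :: l).length : ℤ) := by
            rw [Finset.sum_add_distrib, hedge]
            simpa using ih
  have h := hmk w.toWord
  rwa [FreeGroup.mk_toWord] at h

/-- On the stabilizer of `x`, the path vector based at `x` is a homomorphism. -/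
def stabilizerPathVector (x : X) :
    MulAction.stabilizer (FreeGroup S) x →* Multiplicative (X × S → ℤ) where
  toFun w := Multiplicative.ofAdd (pathVector w.1 x)
  map_one' := by simp [pathVector_one]
  map_mul' u v := by
    have : (v : FreeGroup S) • x = x := v.2
    rw [Subgroup.coe_mul, pathVector_mul, this, add_comm, ofAdd_add]

/-- The words that act trivially on `X` and all of whose path vectors lie in `W`. -/
def pathSubgroup (W : Submodule ℤ (X × S → ℤ)) : Subgroup (FreeGroup S) where
  carrier := {w | ∀ x : X, w • x = x ∧ pathVector w x ∈ W}
  one_mem' x := by simp [pathVector_one]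
  mul_mem' {u v} hu hv x := by
    refine ⟨by rw [mul_smul, (hv x).1, (hu x).1], ?_⟩
    rw [pathVector_mul, (hv x).1]
    exact add_mem (hv x).2 (hu x).2
  inv_mem' {u} hu x := by
    have h : u⁻¹ • x = x := by rw [inv_smul_eq_iff, (hu x).1]
    refine ⟨h, ?_⟩
    rw [pathVector_inv, h]
    exact neg_mem (hu x).2

instance pathSubgroup_normal (W : Submodule ℤ (X × S → ℤ)) : (pathSubgroup W).Normal where
  conj_mem n hn g x := by
    have h := hn (g⁻¹ • x)
    refine ⟨by rw [mul_smul, mul_smul, h.1, smul_inv_smul], ?_⟩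
    rw [pathVector_mul, pathVector_mul, h.1, pathVector_inv]
    simpa using h.2

end PathVector

/-! ### Exponential torsion bound for finite index subgroups. -/

/-- In a finitely presented group, the order of the torsion in the first homology of a subgroup of
finite index grows at most exponentially with the index. -/
theorem exists_card_torsion_abelianization_le_pow_index (A : Type*) [Group A]
    [Group.IsFinitelyPresented A] :
    ∃ C : ℕ, 1 ≤ C ∧ ∀ H : Subgroup A, H.FiniteIndex →
      Finite (CommGroup.torsion (Abelianization H)) ∧
        Nat.card (CommGroup.torsion (Abelianization H)) ≤ C ^ H.index := by
  classical
  obtain ⟨n, φ, hφ, R, hRfin, hRφ⟩ := Group.IsFinitelyPresented.out (G := A)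
  obtain ⟨L, hL⟩ : ∃ L : ℕ, ∀ r ∈ R, r.norm ≤ L :=
    ⟨hRfin.toFinset.sup FreeGroup.norm,
      fun r hr => Finset.le_sup (f := FreeGroup.norm) (hRfin.mem_toFinset.2 hr)⟩
  refine ⟨(L + 1) ^ n, Nat.one_le_pow _ _ (Nat.succ_pos _), fun H hH => ?_⟩
  let X := A ⧸ H
  let _ : MulAction (FreeGroup (Fin n)) X := MulAction.compHom X φ
  let _ : Fintype X := H.fintypeQuotientOfFiniteIndex
  have hsmul : ∀ (w : FreeGroup (Fin n)) (x : X), w • x = φ w • x := fun _ _ => rfl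
  let x₀ : X := ((1 : A) : A ⧸ H)
  let σ : X → A := Quotient.out
  have hσ : ∀ x : X, ((σ x : A) : A ⧸ H) = x := fun x => Quotient.out_eq' x
  have hmem : ∀ (w : FreeGroup (Fin n)) (x : X), (σ (w • x))⁻¹ * (φ w * σ x) ∈ H := by
    intro w x
    rw [← QuotientGroup.eq, hσ]
    change _ = φ w • ((σ x : A) : A ⧸ H)
    rw [hσ, hsmul]
  -- Reidemeister–Schreier rewriting: `σ` is a transversal, and the path of `w` from `x` is closed
  -- up to an element of `H`. By `hgmul` its class is additive along paths, so it factors through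
  -- edge counts as `θ`.
  let g : FreeGroup (Fin n) → X → Abelianization H := fun w x => Abelianization.of ⟨_, hmem w x⟩
  have hgmul : ∀ u v x, g (u * v) x = g v x * g u (v • x) := by
    intro u v x
    rw [mul_comm, ← map_mul]
    refine congrArg _ (Subtype.ext ?_)
    simp only [Subgroup.coe_mul, map_mul, mul_smul]
    group
  let θ : (X × Fin n → ℤ) →ₗ[ℤ] Additive (Abelianization H) :=
    (Pi.basisFun ℤ (X × Fin n)).constr ℤ fun e => Additive.ofMul (g (FreeGroup.of e.2) e.1)
  have hθ : ∀ w x, θ (pathVector w x) = Additive.ofMul (g w x) := by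
    have hone : ∀ x, g 1 x = 1 := by
      intro x
      have h := hgmul 1 1 x
      rw [mul_one, one_smul] at h
      exact mul_eq_left.1 h.symm
    have hof : ∀ s x,
        θ (pathVector (FreeGroup.of s) x) = Additive.ofMul (g (FreeGroup.of s) x) := by
      intro s x
      rw [pathVector_of, ← Pi.basisFun_apply, Module.Basis.constr_basis]
    intro w
    induction w using FreeGroup.induction_on with
    | C1 => intro x; rw [pathVector_one, map_zero, hone]; rfl
    | of s => exact hof s
    | inv_of s _ =>
      intro x
      have h := hgmul (FreeGroup.of s) (FreeGroup.of s)⁻¹ x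
      rw [mul_inv_cancel, hone] at h
      rw [pathVector_inv, map_neg, hof, eq_inv_of_mul_eq_one_left h.symm]
      rfl
    | mul u v hu hv =>
      intro x
      rw [pathVector_mul, map_add, hu, hv, hgmul]
      rfl
  let V : Set (X × Fin n → ℤ) := {v | ∃ r ∈ R, ∃ x : X, v = pathVector r x}
  -- As `pathSubgroup` is normal, checking the relators at every vertex suffices.
  have hker : φ.ker ≤ pathSubgroup (X := X) (Submodule.span ℤ V) := by
    rw [← hRφ]
    refine Subgroup.normalClosure_le_normal fun r hr x =>
      ⟨?_, Submodule.subset_span ⟨r, hr, x, rfl⟩⟩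
    have : φ r = 1 := by
      have : r ∈ φ.ker := hRφ ▸ Subgroup.subset_normalClosure hr
      exact this
    rw [hsmul, this, one_smul]
  have hθV : ∀ v ∈ Submodule.span ℤ V, θ v = 0 := by
    intro v hv
    refine (Submodule.span_le (p := LinearMap.ker θ)).2 ?_ hv
    rintro _ ⟨r, hr, x, rfl⟩
    have h1 : φ r = 1 := by
      have : r ∈ φ.ker := hRφ ▸ Subgroup.subset_normalClosure hr
      exact this
    have h2 : r • x = x := by rw [hsmul, h1, one_smul]
    rw [SetLike.mem_coe, LinearMap.mem_ker, hθ]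
    have : g r x = 1 := by
      rw [← map_one Abelianization.of]
      refine congrArg _ (Subtype.ext ?_)
      simp [h1, h2]
    rw [this]; rfl
  have hstab : MulAction.stabilizer (FreeGroup (Fin n)) x₀ = H.comap φ := by
    ext w
    rw [MulAction.mem_stabilizer_iff, Subgroup.mem_comap, hsmul]
    change ((φ w * 1 : A) : A ⧸ H) = ((1 : A) : A ⧸ H) ↔ _
    rw [eq_comm, QuotientGroup.eq]
    simp
  -- On loops at `x₀`, `g` conjugates by `σ x₀`, which lies in `H` and so does not affect the class.
  have hbase : ∀ (w : FreeGroup (Fin n)) (hw : φ w ∈ H), g w x₀ = Abelianization.of ⟨φ w, hw⟩ := by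
    intro w hw
    have hfix : w • x₀ = x₀ := by
      rw [← MulAction.mem_stabilizer_iff, hstab]; exact hw
    have hσ₀ : σ x₀ ∈ H := by
      have h := hσ x₀
      rw [eq_comm, QuotientGroup.eq] at h
      simpa using h
    have : (⟨_, hmem w x₀⟩ : H) = (⟨σ x₀, hσ₀⟩ : H)⁻¹ * (⟨φ w, hw⟩ * ⟨σ x₀, hσ₀⟩) := by
      refine Subtype.ext ?_
      simp [hfix]
    simp only [g]
    rw [this, map_mul, map_mul, map_inv, mul_comm, mul_assoc, mul_inv_cancel, mul_one]
  have hlift : ∀ t : CommGroup.torsion (Abelianization H), ∃ w : FreeGroup (Fin n),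
      ∃ hw : φ w ∈ H, Abelianization.of ⟨φ w, hw⟩ = (t : Abelianization H) := by
    rintro ⟨t, ht⟩
    obtain ⟨⟨h, hh⟩, rfl⟩ := QuotientGroup.mk_surjective t
    obtain ⟨w, rfl⟩ := hφ h
    exact ⟨w, hh, rfl⟩
  choose w hwH hwt using hlift
  have hcomm : ∀ v : FreeGroup (Fin n), v ∈ ⁅H.comap φ, H.comap φ⁆ →
      pathVector v x₀ = 0 ∧ v • x₀ = x₀ := by
    intro v hv
    rw [← hstab, ← Subgroup.range_subtype (MulAction.stabilizer _ _), ← map_commutator_eq] at hv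
    obtain ⟨v, hv, rfl⟩ := hv
    refine ⟨?_, v.2⟩
    exact Abelianization.commutator_subset_ker (stabilizerPathVector x₀) hv
  -- The bound `L + 1` instead of `L` guarantees the required positivity.
  have key := card_le_pow_of_injective_mod_span (R := V) (L := L + 1) (Nat.succ_pos _) ?_
    (fun t => pathVector (w t) x₀) ?_ ?_
  · refine ⟨key.1, key.2.trans_eq ?_⟩
    rw [Fintype.card_prod, Fintype.card_fin, ← pow_mul, Subgroup.index_eq_card,
      Nat.card_eq_fintype_card, mul_comm]
  · rintro _ ⟨r, hr, x, rfl⟩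
    refine (sum_abs_pathVector_le r x).trans ?_
    exact_mod_cast (hL r hr).trans (Nat.le_succ L)
  · intro t
    obtain ⟨k, hk, hkt⟩ := isOfFinOrder_iff_pow_eq_one.1 ((CommGroup.mem_torsion _).1 t.2)
    refine ⟨k, by exact_mod_cast hk.ne', ?_⟩
    have hpow : pathVector (w t ^ k) x₀ = (k : ℤ) • pathVector (w t) x₀ := by
      have hmem : w t ∈ MulAction.stabilizer (FreeGroup (Fin n)) x₀ := by
        rw [hstab]; exact hwH t
      have := map_pow (stabilizerPathVector x₀) ⟨w t, hmem⟩ k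
      rw [natCast_zsmul]
      exact this
    rw [← hpow]
    -- Up to an element of `φ.ker`, `w t ^ k` is a product of commutators of loops, whose edge count
    -- vanishes; only a combination of lifted relators remains.
    have hφk : φ (w t ^ k) ∈ (⁅H.comap φ, H.comap φ⁆).map φ := by
      rw [Subgroup.map_commutator, Subgroup.map_comap_eq_self_of_surjective hφ,
        ← H.range_subtype, ← map_commutator_eq]
      refine ⟨⟨φ (w t), hwH t⟩ ^ k, ?_, by simp⟩
      rw [← Abelianization.ker_of, SetLike.mem_coe, MonoidHom.mem_ker, map_pow, hwt, hkt]
    obtain ⟨c, hc, hck⟩ := hφk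
    obtain ⟨hc0, hcx⟩ := hcomm c hc
    have hn : w t ^ k * c⁻¹ ∈ φ.ker := by
      rw [MonoidHom.mem_ker, map_mul, map_inv, hck, mul_inv_cancel]
    have : w t ^ k = (w t ^ k * c⁻¹) * c := by group
    rw [this, pathVector_mul, hc0, zero_add, hcx]
    exact (hker hn x₀).2
  · intro t t' htt'
    have h := hθV _ htt'
    rw [map_sub, hθ, hθ, hbase _ (hwH t), hbase _ (hwH t'), hwt, hwt, sub_eq_zero] at h
    exact Subtype.ext (Additive.ofMul.injective h)

/-! ### Commutators in central extensions of finite groups. -/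

section CentralExtension

open scoped commutatorElement

theorem Subgroup.normal_of_le_center {G : Type*} [Group G] {Z : Subgroup G}
    (hZ : Z ≤ Subgroup.center G) : Z.Normal where
  conj_mem z hz g := by rwa [Subgroup.mem_center_iff.1 (hZ hz) g, mul_inv_cancel_right]

theorem MonoidHom.finite_and_card_le_card_ker_mul {G G' : Type*} [Group G] [Group G'] (f : G →* G')
    (hker : Finite f.ker) (hG' : Finite G') :
    Finite G ∧ Nat.card G ≤ Nat.card f.ker * Nat.card G' := by
  have hr : Finite f.range := inferInstance
  refine ⟨f.finite_iff_finite_ker_range.2 ⟨hker, hr⟩, ?_⟩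
  rw [← Subgroup.card_mul_index f.ker, Subgroup.index_ker]
  exact Nat.mul_le_mul_left _ (Nat.card_le_card_of_injective _ Subtype.val_injective)

/-- The homomorphism `g ↦ ⁅g, x⁆` when all these commutators are central. -/
def commutatorHom {G : Type*} [Group G] (x : G) (hx : ∀ g : G, ⁅g, x⁆ ∈ Subgroup.center G) :
    G →* G where
  toFun g := ⁅g, x⁆
  map_one' := by simp
  map_mul' g h := by
    have hh := Subgroup.mem_center_iff.1 (hx h) g
    have h1 : ⁅g * h, x⁆ = g * ⁅h, x⁆ * g⁻¹ * ⁅g, x⁆ := by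
      simp only [commutatorElement_def]; group
    rw [h1, hh, mul_inv_cancel_right]
    exact (Subgroup.mem_center_iff.1 (hx h) _).symm

/-- If the quotient of `G` by a central subgroup has order `p ^ n`, then the commutator subgroup
has order at most `p ^ (n * n)`. -/
theorem card_commutator_le_of_index_eq_prime_pow {p : ℕ} [hp : Fact p.Prime] (n : ℕ)
    {G : Type*} [Group G] {Z : Subgroup G} (hZ : Z ≤ Subgroup.center G) (hn : Z.index = p ^ n) :
    Finite (commutator G) ∧ Nat.card (commutator G) ≤ p ^ (n * n) := by
  induction n generalizing G with
  | zero =>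
    rw [pow_zero, Subgroup.index_eq_one] at hn
    have : commutator G = ⊥ := by
      rw [commutator_def, Subgroup.commutator_eq_bot_iff_le_centralizer,
        Subgroup.coe_top, Subgroup.centralizer_univ, ← hn]
      exact hZ
    rw [this]
    exact ⟨inferInstance, by simp⟩
  | succ n ih =>
    have hZn : Z.Normal := Subgroup.normal_of_le_center hZ
    have hcard : Nat.card (G ⧸ Z) = p ^ (n + 1) := hn
    have hfin : Finite (G ⧸ Z) := Nat.finite_of_card_ne_zero (by
      rw [hcard]; exact pow_ne_zero _ hp.out.ne_zero)
    have hPG : IsPGroup p (G ⧸ Z) := IsPGroup.of_card hcard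
    have hnt : Nontrivial (G ⧸ Z) := Finite.one_lt_card_iff_nontrivial.1 (by
      rw [hcard]; exact Nat.one_lt_pow (Nat.succ_ne_zero n) hp.out.one_lt)
    have hntc := hPG.center_nontrivial
    have hdvd : p ∣ Nat.card (Subgroup.center (G ⧸ Z)) := by
      obtain ⟨k, hk⟩ := (hPG.to_subgroup (Subgroup.center (G ⧸ Z))).exists_card_eq
      rw [hk]
      refine dvd_pow_self p ?_
      rintro rfl
      have := Finite.one_lt_card_iff_nontrivial.2 hntc
      simp [hk] at this
    -- Let `x` lift a central element `y` of order `p`. The commutators with `x` form a central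
    -- subgroup of order dividing `p ^ n`; modulo it, `Z₁`, generated by `x` and `Z`, becomes
    -- central of index `p ^ n`, and induction applies.
    obtain ⟨y, hy⟩ := exists_prime_orderOf_dvd_card' p hdvd
    obtain ⟨x, hx⟩ := QuotientGroup.mk'_surjective Z (y : G ⧸ Z)
    have hxZ : ∀ g : G, ⁅g, x⁆ ∈ Z := by
      intro g
      rw [← QuotientGroup.eq_one_iff, ← QuotientGroup.mk'_apply, map_commutatorElement, hx,
        commutatorElement_eq_one_iff_commute]
      exact Subgroup.mem_center_iff.1 y.2 _
    let f := commutatorHom x fun g => hZ (hxZ g)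
    let Z₁ : Subgroup G := (Subgroup.zpowers (y : G ⧸ Z)).comap (QuotientGroup.mk' Z)
    have hZ₁ : Z₁.index = p ^ n := by
      have h1 : Z₁.index = (Subgroup.zpowers (y : G ⧸ Z)).index :=
        Subgroup.index_comap_of_surjective _ (QuotientGroup.mk'_surjective Z)
      have h2 := Subgroup.card_mul_index (Subgroup.zpowers (y : G ⧸ Z))
      rw [Nat.card_zpowers, Subgroup.orderOf_coe, hy, hcard, pow_succ'] at h2
      rw [h1]
      exact Nat.eq_of_mul_eq_mul_left hp.out.pos h2
    have hmemZ₁ : ∀ g ∈ Z₁, ∃ k : ℤ, ∃ z ∈ Z, g = x ^ k * z := by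
      rintro g ⟨k, hk⟩
      refine ⟨k, (x ^ k)⁻¹ * g, ?_, by group⟩
      rw [← QuotientGroup.eq]
      have : QuotientGroup.mk' Z (x ^ k) = QuotientGroup.mk' Z g := by
        rw [map_zpow, hx]; exact hk
      exact this
    have hZZ₁ : Z ≤ Z₁ := by
      intro z hz
      have : QuotientGroup.mk' Z z = 1 := (QuotientGroup.eq_one_iff z).2 hz
      rw [Subgroup.mem_comap, this]
      exact one_mem _
    have hker : Z₁ ≤ f.ker := by
      intro g hg
      obtain ⟨k, z, hz, rfl⟩ := hmemZ₁ g hg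
      rw [MonoidHom.mem_ker]
      change ⁅x ^ k * z, x⁆ = 1
      rw [commutatorElement_eq_one_iff_commute]
      exact ((Commute.refl x).zpow_left k).mul_left (Subgroup.mem_center_iff.1 (hZ hz) x).symm
    have hK : f.range ≤ Z := by
      rintro _ ⟨g, rfl⟩
      exact hxZ g
    have hKn : f.range.Normal := Subgroup.normal_of_le_center (hK.trans hZ)
    have hKcard : Nat.card f.range ∣ p ^ n := by
      rw [← Subgroup.index_ker, ← hZ₁]
      exact Subgroup.index_dvd_of_le hker
    have hpn : p ^ n ≠ 0 := pow_ne_zero _ hp.out.ne_zero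
    have hKfin : Finite f.range :=
      Nat.finite_of_card_ne_zero (ne_zero_of_dvd_ne_zero hpn hKcard)
    let q := QuotientGroup.mk' f.range
    have hq : Function.Surjective q := QuotientGroup.mk'_surjective _
    have hcentral : Z₁.map q ≤ Subgroup.center (G ⧸ f.range) := by
      rintro _ ⟨g, hg, rfl⟩
      obtain ⟨k, z, hz, rfl⟩ := hmemZ₁ g hg
      rw [Subgroup.mem_center_iff]
      intro b
      obtain ⟨b, rfl⟩ := hq b
      have hbx : Commute (q b) (q x) := by
        rw [← commutatorElement_eq_one_iff_commute, ← map_commutatorElement]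
        exact (QuotientGroup.eq_one_iff _).2 ⟨b, rfl⟩
      have hbz : Commute (q b) (q z) := by
        have : Commute b z := Subgroup.mem_center_iff.1 (hZ hz) b
        exact this.map q
      rw [map_mul, map_zpow]
      exact (hbx.zpow_right k).mul_right hbz
    have hindex : (Z₁.map q).index = p ^ n := by
      rw [Subgroup.index_map_eq _ hq, hZ₁]
      rw [QuotientGroup.ker_mk']
      exact hK.trans hZZ₁
    obtain ⟨hfin', hle⟩ := ih hcentral hindex
    let F : commutator G →* commutator (G ⧸ f.range) :=
      (q.comp (commutator G).subtype).codRestrict _ fun g => by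
        have h : q g ∈ (commutator G).map q := ⟨g, g.2, rfl⟩
        rw [map_commutator_eq, MonoidHom.range_eq_top.2 hq] at h
        exact h
    have hinj : Function.Injective fun g : F.ker =>
        (⟨(g : commutator G), by
          have : (F g : G ⧸ f.range) = 1 := congrArg Subtype.val g.2
          exact (QuotientGroup.eq_one_iff _).1 this⟩ : f.range) := by
      intro a b h
      exact Subtype.ext (Subtype.ext (congrArg (fun y : f.range => (y : G)) h))
    obtain ⟨h1, h2⟩ := F.finite_and_card_le_card_ker_mul (Finite.of_injective _ hinj) hfin'
    refine ⟨h1, h2.trans ?_⟩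
    calc Nat.card F.ker * Nat.card (commutator (G ⧸ f.range))
        ≤ p ^ n * p ^ (n * n) :=
          Nat.mul_le_mul ((Nat.card_le_card_of_injective _ hinj).trans
            (Nat.le_of_dvd (Nat.pos_of_ne_zero hpn) hKcard)) hle
      _ ≤ p ^ ((n + 1) * (n + 1)) := by
          rw [← pow_add]
          exact Nat.pow_le_pow_right hp.out.pos (by nlinarith)

/-- A commutator depends only on the classes of its entries modulo `Z`, so there are finitely many
commutators and Schur's theorem applies. -/
theorem finite_commutator_of_le_center {G : Type*} [Group G] {Z : Subgroup G}
    (hZ : Z ≤ Subgroup.center G) (hfin : Z.FiniteIndex) : Finite (commutator G) := by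
  have hQ : Finite (G ⧸ Z) := Subgroup.finite_quotient_of_finiteIndex
  have : Finite (commutatorSet G) := by
    refine Set.Finite.subset
      (Set.finite_range fun a : (G ⧸ Z) × (G ⧸ Z) => ⁅(a.1.out : G), (a.2.out : G)⁆) ?_
    rintro _ ⟨g, h, rfl⟩
    refine ⟨(g, h), ?_⟩
    obtain ⟨⟨a, ha⟩, hga⟩ := QuotientGroup.mk_out_eq_mul Z g
    obtain ⟨⟨b, hb⟩, hhb⟩ := QuotientGroup.mk_out_eq_mul Z h
    have ha' : ⁅a, h * b⁆ = 1 := commutatorElement_eq_one_iff_commute.2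
      (Subgroup.mem_center_iff.1 (hZ ha) (h * b)).symm
    have hb' : ⁅g, b⁆ = 1 := commutatorElement_eq_one_iff_commute.2
      (Subgroup.mem_center_iff.1 (hZ hb) g)
    simp only [hga, hhb]
    rw [commutatorElement_mul_left_eq_conj_mul, ha', commutatorElement_mul_right_eq_mul_conj, hb']
    simp
  infer_instance

/-- A quantitative form of Schur's theorem: if `Z` is a central subgroup of finite index `q`, then
the order of the intersection of `Z` with the commutator subgroup divides `q ^ log₂ q`. -/
theorem card_commutator_inf_dvd_pow_log {G : Type*} [Group G] {Z : Subgroup G}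
    (hZ : Z ≤ Subgroup.center G) (hfin : Z.FiniteIndex) :
    Nat.card (commutator G ⊓ Z : Subgroup G) ∣ Z.index ^ Nat.log 2 Z.index := by
  have hZn : Z.Normal := Subgroup.normal_of_le_center hZ
  have hG' : Finite (commutator G) := finite_commutator_of_le_center hZ hfin
  have hQ : Finite (G ⧸ Z) := Subgroup.finite_quotient_of_finiteIndex
  have hq0 : Z.index ≠ 0 := hfin.index_ne_zero
  set T : Subgroup G := commutator G ⊓ Z with hT
  have hTfin : Finite T :=
    Finite.of_injective (Subgroup.inclusion (inf_le_left : T ≤ commutator G))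
      (Subgroup.inclusion_injective _)
  rw [← Nat.factorization_prime_le_iff_dvd Nat.card_pos.ne' (pow_ne_zero _ hq0)]
  intro p hp
  have : Fact p.Prime := ⟨hp⟩
  obtain ⟨P⟩ := (inferInstance : Nonempty (Sylow p (G ⧸ Z)))
  obtain ⟨S⟩ := (inferInstance : Nonempty (Sylow p T))
  set n := Z.index.factorization p with hn
  have hPcard : Nat.card P = p ^ n := P.card_eq_multiplicity
  let H : Subgroup G := (P : Subgroup (G ⧸ Z)).comap (QuotientGroup.mk' Z)
  have hHidx : H.index = (P : Subgroup (G ⧸ Z)).index :=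
    Subgroup.index_comap_of_surjective _ (QuotientGroup.mk'_surjective Z)
  have hZH : Z ≤ H := by
    intro z hz
    have : QuotientGroup.mk' Z z = 1 := (QuotientGroup.eq_one_iff z).2 hz
    rw [Subgroup.mem_comap, this]
    exact one_mem _
  have hHfin : H.FiniteIndex := Subgroup.finiteIndex_of_le hZH
  have hrel : (Z.subgroupOf H).index = p ^ n := by
    have h1 := Subgroup.relIndex_mul_index hZH
    have h2 := Subgroup.card_mul_index (P : Subgroup (G ⧸ Z))
    rw [hHidx] at h1
    change _ = Z.index at h2
    rw [← hPcard]
    exact Nat.eq_of_mul_eq_mul_right (Nat.pos_of_ne_zero (hHidx ▸ hHfin.index_ne_zero))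
      (h1.trans h2.symm)
  have hcent : Z.subgroupOf H ≤ Subgroup.center H := by
    intro z hz
    rw [Subgroup.mem_center_iff]
    intro g
    exact Subtype.ext (Subgroup.mem_center_iff.1 (hZ hz) g)
  obtain ⟨hfinH, hleH⟩ := card_commutator_le_of_index_eq_prime_pow n hcent hrel
  -- The transfer to the abelianization of `H` kills commutators and sends a central `t` to the
  -- class of `t ^ H.index`.
  have hcop : ∀ (t : G) (ht : t ∈ T),
      (⟨t ^ H.index, hZH (Z.pow_mem (Subgroup.mem_inf.1 ht).2 _)⟩ : H) ∈ commutator H := by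
    intro t ht
    have hc := Subgroup.mem_center_iff.1 (hZ (Subgroup.mem_inf.1 ht).2)
    have key : ∀ (k : ℕ) (g₀ : G), g₀⁻¹ * t ^ k * g₀ ∈ H → g₀⁻¹ * t ^ k * g₀ = t ^ k := by
      intro k g₀ _
      have : Commute g₀ (t ^ k) := (show Commute g₀ t from hc g₀).pow_right k
      rw [mul_assoc, ← this.eq, inv_mul_cancel_left]
    have h := MonoidHom.transfer_eq_pow (Abelianization.of (G := H)) t key
    have h1 : MonoidHom.transfer (Abelianization.of (G := H)) t = 1 :=
      Abelianization.commutator_subset_ker _ (Subgroup.mem_inf.1 ht).1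
    rw [← Abelianization.ker_of, MonoidHom.mem_ker, ← h1, h]
  -- `H.index` is prime to `p`, so by Bézout `s` is a power of `s ^ H.index`.
  have hmem : ∀ s : S, ((s : T) : G) ∈ H ∧
      ∀ hs : ((s : T) : G) ∈ H, (⟨_, hs⟩ : H) ∈ commutator H := by
    intro s
    have hsT := (s : T).2
    refine ⟨hZH (Subgroup.mem_inf.1 hsT).2, fun hs => ?_⟩
    have h := hcop _ hsT
    obtain ⟨k, hk⟩ := S.isPGroup' s
    have hco : Nat.Coprime (p ^ k) H.index :=
      Nat.Coprime.pow_left k ((Nat.Prime.coprime_iff_not_dvd hp).2 (hHidx ▸ P.not_dvd_index))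
    have hk' : ((s : T) : G) ^ p ^ k = 1 := by
      have := congrArg (fun x : S => ((x : T) : G)) hk
      simpa using this
    have hbez := Nat.gcd_eq_gcd_ab (p ^ k) H.index
    rw [hco.gcd_eq_one] at hbez
    have hpow : (⟨_, hs⟩ : H) =
        (⟨((s : T) : G) ^ H.index, H.pow_mem hs _⟩ : H) ^ (Nat.gcdB (p ^ k) H.index) := by
      refine Subtype.ext ?_
      have h2 : ((s : T) : G) ^ ((1 : ℕ) : ℤ) =
          ((s : T) : G) ^ (((p ^ k : ℕ) : ℤ) * Nat.gcdA (p ^ k) H.index +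
            (H.index : ℤ) * Nat.gcdB (p ^ k) H.index) := by rw [← hbez]
      rw [zpow_add, zpow_mul, zpow_mul, zpow_natCast, zpow_natCast, zpow_natCast, hk', one_zpow,
        one_mul, pow_one] at h2
      exact h2
    rw [hpow]
    exact Subgroup.zpow_mem _ h _
  have hinj : Function.Injective fun s : S =>
      (⟨⟨_, (hmem s).1⟩, (hmem s).2 _⟩ : commutator H) := by
    intro a b h
    exact Subtype.ext (Subtype.ext (congrArg (fun x : commutator H => ((x : H) : G)) h))
  have hS : p ^ (Nat.card T).factorization p ≤ p ^ (n * n) := by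
    rw [← S.card_eq_multiplicity]
    exact (Nat.card_le_card_of_injective _ hinj).trans hleH
  have hS' := (Nat.pow_le_pow_iff_right hp.one_lt).1 hS
  -- The exponent of `p` is at most `n * n`; one factor `n` is bounded by the logarithm because `2 ^
  -- n ≤ p ^ n ≤ Z.index`.
  rw [Nat.factorization_pow, Finsupp.smul_apply, smul_eq_mul]
  refine hS'.trans (Nat.mul_le_mul_right n ?_)
  refine Nat.le_log_of_pow_le one_lt_two ?_
  exact (Nat.pow_le_pow_left hp.two_le n).trans (Nat.ordProj_le p hq0)

end CentralExtension

/-! ### Subgroups of a product and their projections. -/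

section SubgroupOfProduct

open scoped commutatorElement

variable {A B : Type*} [Group A] [Group B]

/-- The homomorphism from the abelianization of a subgroup of a product to the product of the
abelianizations of its projections. -/
noncomputable def abelianizationProjections (U : Subgroup (A × B)) :
    Abelianization U →* Abelianization (U.map (MonoidHom.fst A B)) ×
      Abelianization (U.map (MonoidHom.snd A B)) :=
  (Abelianization.map ((MonoidHom.fst A B).subgroupMap U)).prod
    (Abelianization.map ((MonoidHom.snd A B).subgroupMap U))

theorem map_commutator_eq_of_surjective {G G' : Type*} [Group G] [Group G'] {f : G →* G'}
    (hf : Function.Surjective f) : (commutator G).map f = commutator G' := by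
  rw [map_commutator_eq, MonoidHom.range_eq_top.2 hf, commutator_def]

/-- The first coordinate of a representative is a product of commutators in the projection. Lifting
it to the commutator subgroup of `U` and dividing leaves the class unchanged and the first
coordinate trivial. -/
theorem exists_inr_of_mem_ker_abelianizationProjections (U : Subgroup (A × B))
    {k : Abelianization U} (hk : k ∈ (abelianizationProjections U).ker) :
    ∃ (b : B) (hb : ((1 : A), b) ∈ U) (hb' : b ∈ U.map (MonoidHom.snd A B)),
      Abelianization.of ⟨(1, b), hb⟩ = k ∧
        (⟨b, hb'⟩ : U.map (MonoidHom.snd A B)) ∈ commutator _ := by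
  obtain ⟨u, rfl⟩ := QuotientGroup.mk_surjective k
  have hk' := MonoidHom.mem_ker.1 hk
  have h1 : (MonoidHom.fst A B).subgroupMap U u ∈ commutator (U.map (MonoidHom.fst A B)) := by
    rw [← Abelianization.ker_of]
    exact congrArg Prod.fst hk'
  have h2 : (MonoidHom.snd A B).subgroupMap U u ∈ commutator (U.map (MonoidHom.snd A B)) := by
    rw [← Abelianization.ker_of]
    exact congrArg Prod.snd hk'
  rw [← map_commutator_eq_of_surjective (MonoidHom.subgroupMap_surjective _ U)] at h1
  obtain ⟨c, hc, hcu⟩ := h1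
  have hcu' : (c : A × B).1 = (u : A × B).1 := congrArg Subtype.val hcu
  have heq : ((c⁻¹ * u : U) : A × B) = (1, (c : A × B).2⁻¹ * (u : A × B).2) := by
    refine Prod.ext ?_ rfl
    simp [hcu']
  have hmem : ((1 : A), (c : A × B).2⁻¹ * (u : A × B).2) ∈ U := heq ▸ (c⁻¹ * u).2
  refine ⟨_, hmem, ⟨_, hmem, rfl⟩, ?_, ?_⟩
  · have h3 : (⟨_, hmem⟩ : U) = c⁻¹ * u := Subtype.ext heq.symm
    have h4 : Abelianization.of c = 1 := by
      rw [← MonoidHom.mem_ker, Abelianization.ker_of]; exact hc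
    rw [h3, map_mul, map_inv, h4, inv_one, one_mul]
    rfl
  · have h5 : (MonoidHom.snd A B).subgroupMap U c ∈ commutator (U.map (MonoidHom.snd A B)) := by
      rw [← map_commutator_eq_of_surjective (MonoidHom.subgroupMap_surjective _ U)]
      exact ⟨c, hc, rfl⟩
    exact mul_mem (inv_mem h5) h2

/-- The intersection of a subgroup `U` of `A × B` with `B`, as a subgroup of the projection of `U`
to `B`. -/
def sndKernel (U : Subgroup (A × B)) : Subgroup (U.map (MonoidHom.snd A B)) :=
  (U.comap (MonoidHom.inr A B)).subgroupOf _

theorem mem_sndKernel {U : Subgroup (A × B)} {b : U.map (MonoidHom.snd A B)} :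
    b ∈ sndKernel U ↔ ((1 : A), (b : B)) ∈ U := Iff.rfl

instance sndKernel_normal (U : Subgroup (A × B)) : (sndKernel U).Normal where
  conj_mem n hn g := by
    obtain ⟨_, ⟨a, b⟩, hu, rfl⟩ := g
    rw [mem_sndKernel] at hn ⊢
    have h := U.mul_mem (U.mul_mem hu hn) (U.inv_mem hu)
    simpa using h

/-- If $(a,g) \in U$, then $[(1,n),(a,g)] = (1,[n,g])$, whatever $a$ is. -/
theorem inr_mem_commutator_of_mem_commutator_sndKernel (U : Subgroup (A × B))
    {b : U.map (MonoidHom.snd A B)} (hb : b ∈ ⁅sndKernel U, (⊤ : Subgroup _)⁆) :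
    ((1 : A), (b : B)) ∈ (commutator U).map U.subtype := by
  have hle : ⁅sndKernel U, (⊤ : Subgroup (U.map (MonoidHom.snd A B)))⁆ ≤
      ((commutator U).map U.subtype).comap
        ((MonoidHom.inr A B).comp (U.map (MonoidHom.snd A B)).subtype) := by
    rw [Subgroup.commutator_le]
    rintro n hn ⟨_, ⟨a, g⟩, hu, rfl⟩ -
    refine ⟨⁅(⟨_, mem_sndKernel.1 hn⟩ : U), ⟨_, hu⟩⁆,
      Subgroup.commutator_mem_commutator (Subgroup.mem_top _) (Subgroup.mem_top _), ?_⟩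
    simp [commutatorElement_def]
  exact hle hb

/-- The kernel of the map from the abelianization of `U` to the abelianizations of its projections
is controlled by the Schur multiplier of the finite quotient `U / ((U ∩ A) × (U ∩ B))`. -/
theorem card_ker_abelianizationProjections_le (U : Subgroup (A × B))
    (hfin : (sndKernel U).FiniteIndex) :
    Finite (abelianizationProjections U).ker ∧
      Nat.card (abelianizationProjections U).ker ≤
        (sndKernel U).index ^ Nat.log 2 (sndKernel U).index := by
  let N := sndKernel U
  let M : Subgroup (U.map (MonoidHom.snd A B)) := ⁅N, ⊤⁆
  let q := QuotientGroup.mk' M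
  have hq : Function.Surjective q := QuotientGroup.mk'_surjective M
  have hZ : N.map q ≤ Subgroup.center _ := by
    rintro _ ⟨n, hn, rfl⟩
    rw [Subgroup.mem_center_iff]
    intro g
    obtain ⟨g, rfl⟩ := hq g
    have h : Commute (q n) (q g) := by
      rw [← commutatorElement_eq_one_iff_commute, ← map_commutatorElement]
      exact (QuotientGroup.eq_one_iff _).2
        (Subgroup.commutator_mem_commutator hn (Subgroup.mem_top g))
    exact h.symm
  have hidx : (N.map q).index = N.index := by
    refine Subgroup.index_map_eq _ hq ?_
    rw [QuotientGroup.ker_mk']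
    exact Subgroup.commutator_le_left _ _
  have hZfin : (N.map q).FiniteIndex := ⟨hidx ▸ hfin.index_ne_zero⟩
  have hdvd := card_commutator_inf_dvd_pow_log hZ hZfin
  rw [hidx] at hdvd
  have hpos : N.index ^ Nat.log 2 N.index ≠ 0 := pow_ne_zero _ hfin.index_ne_zero
  have hTfin := Nat.finite_of_card_ne_zero (ne_zero_of_dvd_ne_zero hpos hdvd)
  choose b hb hb' hbk hbc using fun k : (abelianizationProjections U).ker =>
    exists_inr_of_mem_ker_abelianizationProjections U k.2
  have hmem : ∀ k, q ⟨b k, hb' k⟩ ∈ commutator _ ⊓ N.map q := fun k =>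
    ⟨map_commutator_eq_of_surjective hq ▸ ⟨_, hbc k, rfl⟩, ⟨_, hb k, rfl⟩⟩
  have hinj : Function.Injective fun k =>
      (⟨_, hmem k⟩ : (commutator _ ⊓ N.map q : Subgroup _)) := by
    intro k l hkl
    have h1 : (QuotientGroup.mk (⟨b k, hb' k⟩ : U.map (MonoidHom.snd A B)) : _ ⧸ M) =
        QuotientGroup.mk ⟨b l, hb' l⟩ := congrArg Subtype.val hkl
    rw [QuotientGroup.eq] at h1
    obtain ⟨c, hc, hcb⟩ := inr_mem_commutator_of_mem_commutator_sndKernel U h1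
    have h2 : c = (⟨(1, b k), hb k⟩ : U)⁻¹ * ⟨(1, b l), hb l⟩ := by
      refine Subtype.ext (hcb.trans ?_)
      simp
    refine Subtype.ext ?_
    rw [← hbk k, ← hbk l]
    exact QuotientGroup.eq.2 (h2 ▸ hc)
  exact ⟨Finite.of_injective _ hinj, (Nat.card_le_card_of_injective _ hinj).trans
    (Nat.le_of_dvd (Nat.pos_of_ne_zero hpos) hdvd)⟩

theorem CommGroup.finite_torsion_and_card_le {G G₁ G₂ : Type*} [CommGroup G] [CommGroup G₁]
    [CommGroup G₂] (f : G →* G₁ × G₂) (hker : Finite f.ker)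
    (h₁ : Finite (CommGroup.torsion G₁)) (h₂ : Finite (CommGroup.torsion G₂)) :
    Finite (CommGroup.torsion G) ∧ Nat.card (CommGroup.torsion G) ≤
      Nat.card f.ker * (Nat.card (CommGroup.torsion G₁) * Nat.card (CommGroup.torsion G₂)) := by
  let F : CommGroup.torsion G →* CommGroup.torsion G₁ × CommGroup.torsion G₂ :=
    ((((MonoidHom.fst G₁ G₂).comp f).comp (CommGroup.torsion G).subtype).codRestrict _ fun t =>
      MonoidHom.isOfFinOrder ((MonoidHom.fst G₁ G₂).comp f) t.2).prod
    ((((MonoidHom.snd G₁ G₂).comp f).comp (CommGroup.torsion G).subtype).codRestrict _ fun t =>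
      MonoidHom.isOfFinOrder ((MonoidHom.snd G₁ G₂).comp f) t.2)
  have hinj : Function.Injective fun t : F.ker => (⟨((t : CommGroup.torsion G) : G), by
      have h := MonoidHom.mem_ker.1 t.2
      exact Prod.ext (congrArg (fun x => (x.1 : G₁)) h) (congrArg (fun x => (x.2 : G₂)) h)⟩ :
      f.ker) := by
    intro a b h
    exact Subtype.ext (Subtype.ext (congrArg (fun x : f.ker => (x : G)) h))
  obtain ⟨h3, h4⟩ := F.finite_and_card_le_card_ker_mul (Finite.of_injective _ hinj) inferInstance
  refine ⟨h3, h4.trans ?_⟩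
  rw [Nat.card_prod]
  exact Nat.mul_le_mul_right _ (Nat.card_le_card_of_injective _ hinj)

/-- The index of `U` factors through `U ⊔ f.ker`, whose index is that of the image. -/
theorem Subgroup.index_map_mul_relIndex_ker_le {G G' : Type*} [Group G] [Group G'] {f : G →* G'}
    (hf : Function.Surjective f) (U : Subgroup G) (hU : U.FiniteIndex) :
    (U.map f).index * U.relIndex f.ker ≤ U.index := by
  have h1 : (U.map f).index = (U ⊔ f.ker).index := by
    rw [Subgroup.index_map, MonoidHom.range_eq_top.2 hf, Subgroup.index_top, mul_one]
  have h2 : U.relIndex (U ⊔ f.ker) ≠ 0 := by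
    have := Subgroup.isFiniteRelIndex_of_finiteIndex (H := U) (K := U ⊔ f.ker)
    exact Subgroup.relIndex_ne_zero
  rw [h1, ← Subgroup.relIndex_mul_index (le_sup_left : U ≤ U ⊔ f.ker), mul_comm]
  exact Nat.mul_le_mul_right _ (Subgroup.relIndex_le_of_le_right le_sup_right h2)

end SubgroupOfProduct

/-! ### Assembling the estimates and passing to the limit. -/

/-- The torsion in the abelianization of a finite index subgroup of `A × B` is bounded in terms of
the indices of its projections, up to a factor of subexponential size in the index. -/
theorem exists_log_card_torsion_le (A B : Type*) [Group A] [Group B]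
    [Group.IsFinitelyPresented A] [Group.IsFinitelyPresented B] :
    ∃ C : ℝ, ∀ U : Subgroup (A × B), U.FiniteIndex →
      Finite (CommGroup.torsion (Abelianization U)) ∧
      Real.log (Nat.card (CommGroup.torsion (Abelianization U))) ≤
        C * (U.map (MonoidHom.fst A B)).index + C * (U.map (MonoidHom.snd A B)).index +
          (Real.log 2)⁻¹ * Real.log U.index ^ 2 := by
  obtain ⟨a, ha1, ha⟩ := exists_card_torsion_abelianization_le_pow_index A
  obtain ⟨b, hb1, hb⟩ := exists_card_torsion_abelianization_le_pow_index B
  refine ⟨Real.log a + Real.log b, fun U hU => ?_⟩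
  have hUA : (U.map (MonoidHom.fst A B)).FiniteIndex :=
    ⟨ne_zero_of_dvd_ne_zero hU.index_ne_zero (Subgroup.index_map_dvd _ Prod.fst_surjective)⟩
  have hUB : (U.map (MonoidHom.snd A B)).FiniteIndex :=
    ⟨ne_zero_of_dvd_ne_zero hU.index_ne_zero (Subgroup.index_map_dvd _ Prod.snd_surjective)⟩
  obtain ⟨hfA, hcA⟩ := ha _ hUA
  obtain ⟨hfB, hcB⟩ := hb _ hUB
  -- $[U_B : U \cap B] \le [B : U \cap B] \le [G : U]$.
  have hNle : (sndKernel U).index ≠ 0 ∧ (sndKernel U).index ≤ U.index := by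
    have h1 : (U.comap (MonoidHom.inr A B)).index ≠ 0 ∧
        (U.comap (MonoidHom.inr A B)).index ≤ U.index := by
      rw [Subgroup.index_comap]
      have := Subgroup.isFiniteRelIndex_of_finiteIndex (H := U) (K := (MonoidHom.inr A B).range)
      refine ⟨Subgroup.relIndex_ne_zero, ?_⟩
      rw [← U.relIndex_top_right]
      exact Subgroup.relIndex_le_of_le_right le_top (by simpa using hU.index_ne_zero)
    have h2 : (U.comap (MonoidHom.inr A B)).FiniteIndex := ⟨h1.1⟩
    have := Subgroup.isFiniteRelIndex_of_finiteIndex (H := U.comap (MonoidHom.inr A B))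
      (K := U.map (MonoidHom.snd A B))
    refine ⟨Subgroup.relIndex_ne_zero (H := U.comap (MonoidHom.inr A B)), le_trans ?_ h1.2⟩
    rw [← (U.comap (MonoidHom.inr A B)).relIndex_top_right]
    exact Subgroup.relIndex_le_of_le_right le_top (by simpa using h1.1)
  obtain ⟨hfK, hcK⟩ := card_ker_abelianizationProjections_le U ⟨hNle.1⟩
  obtain ⟨hfT, hcT⟩ := CommGroup.finite_torsion_and_card_le
    (abelianizationProjections U) hfK hfA hfB
  refine ⟨hfT, ?_⟩
  have hN0 : 0 < U.index := Nat.pos_of_ne_zero hU.index_ne_zero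
  have hK : (sndKernel U).index ^ Nat.log 2 (sndKernel U).index ≤ U.index ^ Nat.log 2 U.index :=
    (Nat.pow_le_pow_left hNle.2 _).trans
      (Nat.pow_le_pow_right hN0 (Nat.log_mono_right hNle.2))
  have hT := hcT.trans (Nat.mul_le_mul (hcK.trans hK) (Nat.mul_le_mul hcA hcB))
  have hpos : 0 < Nat.card (CommGroup.torsion (Abelianization U)) := Nat.card_pos
  have hN0' : (U.index : ℝ) ≠ 0 := by exact_mod_cast hN0.ne'
  have ha0 : (a : ℝ) ≠ 0 := by exact_mod_cast (Nat.pos_of_ne_zero (by omega)).ne'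
  have hb0 : (b : ℝ) ≠ 0 := by exact_mod_cast (Nat.pos_of_ne_zero (by omega)).ne'
  have hlog := Real.log_le_log (Nat.cast_pos.2 hpos) (Nat.cast_le (α := ℝ).2 hT)
  push_cast at hlog
  rw [Real.log_mul (pow_ne_zero _ hN0') (mul_ne_zero (pow_ne_zero _ ha0) (pow_ne_zero _ hb0)),
    Real.log_mul (pow_ne_zero _ ha0) (pow_ne_zero _ hb0), Real.log_pow, Real.log_pow,
    Real.log_pow] at hlog
  have hla : 0 ≤ Real.log a := Real.log_natCast_nonneg a
  have hlb : 0 ≤ Real.log b := Real.log_natCast_nonneg b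
  have hlN : 0 ≤ Real.log U.index := Real.log_natCast_nonneg _
  have hnl : (Nat.log 2 U.index : ℝ) * Real.log U.index ≤
      (Real.log 2)⁻¹ * Real.log U.index ^ 2 := by
    have h := Real.natLog_le_logb U.index 2
    rw [Real.logb, Nat.cast_ofNat, div_eq_inv_mul] at h
    calc (Nat.log 2 U.index : ℝ) * Real.log U.index
        ≤ ((Real.log 2)⁻¹ * Real.log U.index) * Real.log U.index :=
          mul_le_mul_of_nonneg_right h hlN
      _ = _ := by ring
  have h5 : 0 ≤ Real.log b * ((U.map (MonoidHom.fst A B)).index : ℝ) := by positivity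
  have h6 : 0 ≤ Real.log a * ((U.map (MonoidHom.snd A B)).index : ℝ) := by positivity
  nlinarith

theorem theorem2 {A B : Type*} [Group A] [Group B]
    [Group.IsFinitelyPresented A] [Group.IsFinitelyPresented B]
    (U : ℕ → Subgroup (A × B)) (hU : ∀ n, (U n).FiniteIndex)
    (hA : Tendsto (fun n => (U n).relIndex (MonoidHom.inl A B).range) atTop atTop)
    (hB : Tendsto (fun n => (U n).relIndex (MonoidHom.inr A B).range) atTop atTop) :
    (∀ n, Finite (CommGroup.torsion (Abelianization (U n)))) ∧
      Tendsto
        (fun n => Real.log (Nat.card (CommGroup.torsion (Abelianization (U n)))) /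
          ((U n).index : ℝ))
        atTop (𝓝 0) := by
  obtain ⟨C, hC⟩ := exists_log_card_torsion_le A B
  refine ⟨fun n => (hC (U n) (hU n)).1, ?_⟩
  have hkfst : (MonoidHom.fst A B).ker = (MonoidHom.inr A B).range := by
    ext ⟨x, y⟩; simp [Subgroup.mem_prod, eq_comm]
  have hksnd : (MonoidHom.snd A B).ker = (MonoidHom.inl A B).range := by
    ext ⟨x, y⟩; simp [Subgroup.mem_prod, eq_comm]
  -- The factors cross over: the index of the projection to $A$ is paired with $[B : B \cap U_n]$,
  -- and conversely. Thus each hypothesis makes the opposite projection term negligible.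
  have hfst : ∀ n, ((U n).map (MonoidHom.fst A B)).index *
      (U n).relIndex (MonoidHom.inr A B).range ≤ (U n).index := fun n =>
    hkfst ▸ Subgroup.index_map_mul_relIndex_ker_le Prod.fst_surjective (U n) (hU n)
  have hsnd : ∀ n, ((U n).map (MonoidHom.snd A B)).index *
      (U n).relIndex (MonoidHom.inl A B).range ≤ (U n).index := fun n =>
    hksnd ▸ Subgroup.index_map_mul_relIndex_ker_le Prod.snd_surjective (U n) (hU n)
  have hindex : Tendsto (fun n => ((U n).index : ℝ)) atTop atTop := by
    refine tendsto_natCast_atTop_atTop.comp (tendsto_atTop_mono (fun n => ?_) hB)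
    refine le_trans (Nat.le_mul_of_pos_left _ (Nat.pos_of_ne_zero ?_)) (hfst n)
    exact ne_zero_of_dvd_ne_zero (hU n).index_ne_zero
      (Subgroup.index_map_dvd _ Prod.fst_surjective)
  have hratio : ∀ {i r : ℕ → ℕ}, (∀ n, i n * r n ≤ (U n).index) → Tendsto r atTop atTop →
      Tendsto (fun n => C * ((i n : ℝ) / ((U n).index : ℝ))) atTop (𝓝 0) := by
    intro i r hle hr
    rw [← mul_zero C]
    refine Tendsto.const_mul C ?_
    refine squeeze_zero' (Eventually.of_forall fun n => by positivity) ?_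
      (tendsto_inv_atTop_zero.comp (tendsto_natCast_atTop_atTop (R := ℝ).comp hr))
    filter_upwards [hr.eventually_gt_atTop 0] with n hn
    have hN : (0 : ℝ) < (U n).index := by
      exact_mod_cast Nat.pos_of_ne_zero (hU n).index_ne_zero
    have hn' : (0 : ℝ) < r n := by exact_mod_cast hn
    have h : (i n : ℝ) * r n ≤ (U n).index := by exact_mod_cast hle n
    rw [Function.comp_apply, Function.comp_apply, div_le_iff₀ hN, inv_mul_eq_div, le_div_iff₀ hn']
    exact h
  have hlogsq : Tendsto (fun n => (Real.log 2)⁻¹ * (Real.log (U n).index ^ 2 / (U n).index))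
      atTop (𝓝 0) := by
    rw [← mul_zero (Real.log 2)⁻¹]
    exact ((Real.isLittleO_pow_log_id_atTop (n := 2)).tendsto_div_nhds_zero.comp hindex).const_mul _
  have hsum := ((hratio hfst hB).add (hratio hsnd hA)).add hlogsq
  rw [add_zero, add_zero] at hsum
  refine squeeze_zero (fun n => div_nonneg (Real.log_natCast_nonneg _) (Nat.cast_nonneg _))
    (fun n => ?_) hsum
  have hN : (0 : ℝ) < (U n).index := by
    exact_mod_cast Nat.pos_of_ne_zero (hU n).index_ne_zero
  refine (div_le_div_of_nonneg_right (hC (U n) (hU n)).2 hN.le).trans_eq ?_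
  ring
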